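/- Let $\ell,r\ge 1$ and $n\ge 0$ be integers, put $k=\ell r$, and assume that $n$ is even or $\ell\ge 3$. Write $\mathbb V=\mathbb F_2^n$, $\langle u,x\rangle=\sum_i u_ix_i\in\mathbb F_2$ and $\zeta_{2^m}=e^{2\pi i/2^m}$. For $f:\mathbb V\to\mathbb Z_{2^k}$ let $W_f(u)=\sum_{x\in\mathbb V}\zeta_{2^k}^{f(x)}(-1)^{\langle u,x\rangle}$; $f$ is gbent if $|W_f(u)|=2^{n/2}$ for all $u\in\mathbb V$, and a function $\widetilde f:\mathbb V\to\mathbb Z_{2^k}$ is a dual of $f$ if $W_f(u)=2^{n/2}\zeta_{2^k}^{\widetilde f(u)}$ for all $u\in\mathbb V$. The $2^\ell$-adic components $c_0,\dots,c_{r-1}:\mathbb V\to\mathbb Z_{2^\ell}$ of $f$ are the base-$2^\ell$ digits of its values: $f(x)=\sum_{j=0}^{r-1}c_j(x)2^{j\ell}$ with $0\le c_j(x)<2^\ell$. For $\alpha\in(\mathbb Z_{2^\ell})^{r-1}$ and $u\in\mathbb V$ put $P_\alpha=\{x\in\mathbb V: c_j(x)=\alpha_j \text{ for } 0\le j\le r-2\}$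 and $$C_\alpha(u)=\sum_{x\in P_\alpha}\zeta_{2^\ell}^{c_{r-1}(x)}(-1)^{\langle u,x\rangle}.$$ Proposition. Let $f:\mathbb V\to\mathbb Z_{2^k}$ be gbent. Then $f$ has exactly one dual $\widetilde f$. Let $\widetilde c_0,\dots,\widetilde c_{r-1}$ be the $2^\ell$-adic components of $\widetilde f$. For each $u\in\mathbb V$ there is exactly one $\alpha=\alpha^*(u)\in(\mathbb Z_{2^\ell})^{r-1}$ with $C_\alpha(u)\ne 0$, and $$(\widetilde c_0(u),\dots,\widetilde c_{r-2}(u))=\alpha^*(u).$$ -/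

import Mathlib

namespace Gbent

/-- The Boolean space `𝔽₂ⁿ`. -/
abbrev V (n : ℕ) : Type := Fin n → ZMod 2

/-- The root of unity `ζ_{2^k} = exp (2πi / 2^k)`. -/
noncomputable def zeta (k : ℕ) : ℂ := Complex.exp (2 * Real.pi * Complex.I / (2 : ℂ) ^ k)

/-- The sign `(-1)^⟨u, x⟩`, where `⟨u, x⟩ = ∑ uᵢ xᵢ` in `𝔽₂`. -/
def sign {n : ℕ} (u x : V n) : ℂ := (-1 : ℂ) ^ (u ⬝ᵥ x).val

/-- The (unnormalized) Walsh-Hadamard transform of `f : 𝔽₂ⁿ → ℤ/2^k`. -/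
noncomputable def WHT {n k : ℕ} (f : V n → ZMod (2 ^ k)) (u : V n) : ℂ :=
  ∑ x : V n, zeta k ^ (f x).val * sign u x

/-- Generalized bent functions: `|WHT_f(u)| = 2^{n/2}` for all `u`. -/
def IsGbent {n k : ℕ} (f : V n → ZMod (2 ^ k)) : Prop :=
  ∀ u : V n, ‖WHT f u‖ = (2 : ℝ) ^ ((n : ℝ) / 2)

/-- `g` is a dual of `f`: `WHT_f(u) = 2^{n/2} ζ_{2^k}^{g(u)}` for all `u`. -/
def IsDual {n k : ℕ} (f g : V n → ZMod (2 ^ k)) : Prop :=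
  ∀ u : V n, WHT f u = (((2 : ℝ) ^ ((n : ℝ) / 2) : ℝ) : ℂ) * zeta k ^ (g u).val

/-- The `j`-th `2^ℓ`-adic component `c_j` of `f`: `c_j(x)` is the `j`-th digit in base `2^ℓ` of the
representative of `f x` in `{0, …, 2^k - 1}`. -/
def component {n k : ℕ} (ℓ : ℕ) (f : V n → ZMod (2 ^ k)) (j : ℕ) (x : V n) : ZMod (2 ^ ℓ) :=
  (((f x).val / 2 ^ (j * ℓ) : ℕ) : ZMod (2 ^ ℓ))

/-- The components indeed give the expansion `f(x) = ∑_{j < r} c_j(x) 2^{jℓ}`. -/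
theorem sum_component {n k ℓ r : ℕ} (hk : k = ℓ * r) (f : V n → ZMod (2 ^ k)) (x : V n) :
    f x = ∑ j ∈ Finset.range r, ((component ℓ f j x).val : ZMod (2 ^ k)) * 2 ^ (j * ℓ) := by
  have key : ∀ s a : ℕ,
      ∑ j ∈ Finset.range s, (a / 2 ^ (j * ℓ) % 2 ^ ℓ) * 2 ^ (j * ℓ) = a % 2 ^ (s * ℓ) := by
    intro s a
    induction s with
    | zero => simp [Nat.mod_one]
    | succ s ih =>
      rw [Finset.sum_range_succ, ih, Nat.succ_mul, pow_add, Nat.mod_mul]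
      ring
  have h := key r (f x).val
  rw [Nat.mul_comm r ℓ, ← hk, Nat.mod_eq_of_lt (ZMod.val_lt (f x))] at h
  have h2 := congrArg (Nat.cast : ℕ → ZMod (2 ^ k)) h
  rw [ZMod.natCast_zmod_val] at h2
  rw [← h2]
  simp [component, ZMod.val_natCast]

/-- The tuple `(c_0(x), …, c_{r-2}(x))` of the lower `r - 1` components of `f` at `x`. -/
def lower {n k : ℕ} (ℓ r : ℕ) (f : V n → ZMod (2 ^ k)) (x : V n) : Fin (r - 1) → ZMod (2 ^ ℓ) :=
  fun j => component ℓ f j x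

/-- The partition cell `P_α = {x | c_0(x) = α_0, …, c_{r-2}(x) = α_{r-2}}`. -/
def cell {n k : ℕ} (ℓ r : ℕ) (f : V n → ZMod (2 ^ k)) (α : Fin (r - 1) → ZMod (2 ^ ℓ)) :
    Finset (V n) :=
  Finset.univ.filter fun x => lower ℓ r f x = α

/-- The partition coefficient `C_α(u) = ∑_{x ∈ P_α} ζ_{2^ℓ}^{c_{r-1}(x)} (-1)^⟨u, x⟩`. -/
noncomputable def coeff {n k : ℕ} (ℓ r : ℕ) (f : V n → ZMod (2 ^ k))
    (α : Fin (r - 1) → ZMod (2 ^ ℓ)) (u : V n) : ℂ :=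
  ∑ x ∈ cell ℓ r f α, zeta ℓ ^ (component ℓ f (r - 1) x).val * sign u x

end Gbent

namespace Gbent

open NumberField Polynomial

/-! Put `z = ζ_{2^k}`. Both `W_f(u)` and `2^{n/2}` lie in `ℤ[z]` and have squared absolute value
`2^n`, so both divide `2^n` there. As 2 is totally ramified, one divides the other; the quotient has
absolute value 1 in every embedding, hence by Kronecker is a root of unity, a power of `z`. This
gives the dual (`exists_aeval_eq_pow_mul`).

With `s = (r-1)ℓ`, splitting exponents mod `2^s` gives `W_f(u) = ∑_{i<2^s} C_i(u) z^i` with `C_i(u)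
∈ ℚ(ζ_{2^ℓ})`. The `z^i` are independent over this field (`linearIndependent_zeta_pow`) and
`2^{n/2}` lies in it, so comparison with `2^{n/2} z^{f̃(u)}` leaves only `i = f̃(u) mod 2^s`. -/

theorem conj_aeval_eq {N : ℕ} (hN : N ≠ 0) {z : ℂ} (hz : z ^ N = 1) (p : ℤ[X]) :
    (starRingEnd ℂ) (aeval z p) = aeval (z ^ (N - 1)) p := by
  have h : (starRingEnd ℂ) z = z ^ (N - 1) := by
    have hn : ‖z‖ = 1 := Complex.norm_eq_one_of_pow_eq_one hz hN
    rw [← Complex.inv_eq_conj hn]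
    refine inv_eq_of_mul_eq_one_right ?_
    rw [← pow_succ', Nat.sub_add_cancel (Nat.one_le_iff_ne_zero.2 hN), hz]
  rw [← h, aeval_def, aeval_def, hom_eval₂]
  congr 1
  exact RingHom.ext_int _ _

/-! ### Arithmetic of the ring of integers of `ℚ(ζ_{2^{m+1}})` -/

section Cyclotomic

variable {K : Type*} [Field K] [NumberField K] {m : ℕ} [IsCyclotomicExtension {2 ^ (m + 1)} ℚ K]
  {ζ : K}

theorem associated_two_pow (hζ : IsPrimitiveRoot ζ (2 ^ (m + 1))) :
    Associated (2 : 𝓞 K) ((hζ.toInteger - 1) ^ Module.finrank ℚ K) := by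
  have h := IsCyclotomicExtension.Rat.map_eq_span_zeta_sub_one_pow 2 m hζ
  rw [Ideal.map_span, Set.image_singleton, Ideal.span_singleton_pow,
    Ideal.span_singleton_eq_span_singleton] at h
  simpa using h

/-- Divisors of a power of `2` are linearly ordered by divisibility: `2` is totally ramified. -/
theorem dvd_or_dvd_of_dvd_two_pow (hζ : IsPrimitiveRoot ζ (2 ^ (m + 1))) {n : ℕ} {a b : 𝓞 K}
    (ha : a ∣ 2 ^ n) (hb : b ∣ 2 ^ n) : a ∣ b ∨ b ∣ a := by
  have h : Associated ((2 : 𝓞 K) ^ n) ((hζ.toInteger - 1) ^ (Module.finrank ℚ K * n)) := by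
    rw [pow_mul]
    exact (associated_two_pow hζ).pow_pow
  obtain ⟨i, -, hi⟩ := (dvd_prime_pow hζ.zeta_sub_one_prime _).1 (ha.trans h.dvd)
  obtain ⟨j, -, hj⟩ := (dvd_prime_pow hζ.zeta_sub_one_prime _).1 (hb.trans h.dvd)
  rw [hi.dvd_iff_dvd_left, hj.dvd_iff_dvd_right, hi.dvd_iff_dvd_right, hj.dvd_iff_dvd_left]
  exact (le_total i j).imp (pow_dvd_pow _) (pow_dvd_pow _)

theorem exists_eq_pow_of_isOfFinOrder (hζ : IsPrimitiveRoot ζ (2 ^ (m + 1))) {x : K}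
    (hx : IsOfFinOrder x) : ∃ j : ℕ, x = ζ ^ j := by
  have hprim := IsPrimitiveRoot.orderOf x
  have hpos : 0 < orderOf x := hx.orderOf_pos
  have hdvd := hprim.dvd_of_isCyclotomicExtension (2 ^ (m + 1)) hpos.ne'
  rw [← pow_succ', Nat.dvd_prime_pow Nat.prime_two] at hdvd
  obtain ⟨i, -, hi⟩ := hdvd
  -- Divisibility still allows order `2^{m+2}`; the bound `φ(2^i) ≤ [K:ℚ] = 2^m` excludes it.
  have hle := hprim.lcm_totient_le_finrank (K := ℚ) IsPrimitiveRoot.one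
    (cyclotomic.irreducible_rat (by simpa using hpos))
  rw [IsCyclotomicExtension.finrank (n := 2 ^ (m + 1)) K
      (cyclotomic.irreducible_rat (by positivity)), Nat.lcm_one_right, hi,
    Nat.totient_prime_pow_succ Nat.prime_two] at hle
  have him : i ≤ m + 1 := by
    rcases i with _ | i
    · omega
    · rw [Nat.totient_prime_pow_succ Nat.prime_two] at hle
      have := (Nat.pow_le_pow_iff_right (a := 2) one_lt_two).1 (by simpa using hle)
      omega
  obtain ⟨j, -, hj⟩ := hζ.eq_pow_of_pow_eq_one
    (orderOf_dvd_iff_pow_eq_one.1 (hi ▸ pow_dvd_pow 2 him))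
  exact ⟨j, hj.symm⟩

theorem exists_eq_pow_mul_of_dvd (hζ : IsPrimitiveRoot ζ (2 ^ (m + 1))) {a b : 𝓞 K}
    (hb : b ≠ 0) (hba : b ∣ a) (h : ∀ φ : K →+* ℂ, ‖φ (algebraMap (𝓞 K) K a)‖ = ‖φ (algebraMap (𝓞 K) K b)‖) :
    ∃ j : ℕ, algebraMap (𝓞 K) K a = ζ ^ j * algebraMap (𝓞 K) K b := by
  obtain ⟨c, rfl⟩ := hba
  have hc : ∀ φ : K →+* ℂ, ‖φ (algebraMap (𝓞 K) K c)‖ = 1 := fun φ ↦ by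
    have h0 : ‖φ (algebraMap (𝓞 K) K b)‖ ≠ 0 := by simpa using hb
    have := h φ
    rw [map_mul, map_mul, norm_mul] at this
    exact (mul_eq_left₀ h0).1 this
  obtain ⟨N, hN, hcN⟩ := Embeddings.pow_eq_one_of_norm_eq_one K ℂ c.isIntegral_coe hc
  obtain ⟨j, hj⟩ := exists_eq_pow_of_isOfFinOrder hζ (isOfFinOrder_iff_pow_eq_one.2 ⟨N, hN, hcN⟩)
  exact ⟨j, by rw [map_mul, hj, mul_comm]⟩

theorem exists_eq_pow_mul (hζ : IsPrimitiveRoot ζ (2 ^ (m + 1))) {n : ℕ} {a b : 𝓞 K}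
    (ha : a ∣ 2 ^ n) (hb : b ∣ 2 ^ n) (h : ∀ φ : K →+* ℂ, ‖φ (algebraMap (𝓞 K) K a)‖ = ‖φ (algebraMap (𝓞 K) K b)‖) :
    ∃ j : ℕ, algebraMap (𝓞 K) K a = ζ ^ j * algebraMap (𝓞 K) K b := by
  have h2 : (2 : 𝓞 K) ^ n ≠ 0 := pow_ne_zero _ two_ne_zero
  rcases dvd_or_dvd_of_dvd_two_pow hζ ha hb with hab | hba
  · obtain ⟨j, hj⟩ := exists_eq_pow_mul_of_dvd hζ (ne_zero_of_dvd_ne_zero h2 ha) hab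
      fun φ ↦ (h φ).symm
    -- This exponent represents `-j`.
    refine ⟨(2 ^ (m + 1) - 1) * j, ?_⟩
    rw [hj, ← mul_assoc, ← pow_add, ← Nat.succ_mul, Nat.succ_eq_add_one,
      Nat.sub_add_cancel Nat.one_le_two_pow, pow_mul, hζ.pow_eq_one, one_pow, one_mul]
  · exact exists_eq_pow_mul_of_dvd hζ (ne_zero_of_dvd_ne_zero h2 hb) hba h

theorem exists_ringHom_eq (hζ : IsPrimitiveRoot ζ (2 ^ (m + 1))) {z : ℂ}
    (hz : IsPrimitiveRoot z (2 ^ (m + 1))) : ∃ ψ : K →+* ℂ, ψ ζ = z := by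
  have hirr : Irreducible (cyclotomic (2 ^ (m + 1)) ℚ) :=
    cyclotomic.irreducible_rat (by positivity)
  refine ⟨((hζ.embeddingsEquivPrimitiveRoots ℂ hirr).symm
    ⟨z, (mem_primitiveRoots (by positivity)).2 hz⟩ : K →ₐ[ℚ] ℂ), ?_⟩
  have := hζ.embeddingsEquivPrimitiveRoots_apply_coe ℂ hirr
    ((hζ.embeddingsEquivPrimitiveRoots ℂ hirr).symm
      ⟨z, (mem_primitiveRoots (by positivity)).2 hz⟩)
  rw [Equiv.apply_symm_apply] at this
  exact this.symm

/-- Conjugation acts as `ζ ↦ ζ^{N-1}` with `N = 2^{m+1}`, so `|p(z)|² = 2^n` pulls back along `ψ` to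
an identity in `𝓞 K`, which then gives the same absolute value in every embedding. -/
theorem exists_aeval_eq_pow_mul_of_ringHom (hζ : IsPrimitiveRoot ζ (2 ^ (m + 1))) {z : ℂ} {n : ℕ}
    (ψ : K →+* ℂ) (hψ : ψ ζ = z)
    {p q : ℤ[X]} (hp : ‖aeval z p‖ ^ 2 = 2 ^ n) (hq : ‖aeval z q‖ ^ 2 = 2 ^ n) :
    ∃ j : ℕ, aeval z p = z ^ j * aeval z q := by
  have haeval : ∀ (φ : K →+* ℂ) (e : ℕ) (p : ℤ[X]),
      φ (algebraMap (𝓞 K) K (aeval (hζ.toInteger ^ e) p)) = aeval (φ ζ ^ e) p := fun φ e p ↦ by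
    have := hom_eval₂ p (algebraMap ℤ (𝓞 K)) (φ.comp (algebraMap (𝓞 K) K)) (hζ.toInteger ^ e)
    rw [map_pow] at this
    rw [aeval_def, aeval_def]
    refine this.trans ?_
    congr 1
    exact RingHom.ext_int _ _
  have hmul : ∀ (φ : K →+* ℂ) (p : ℤ[X]),
      φ (algebraMap (𝓞 K) K
        (aeval hζ.toInteger p * aeval (hζ.toInteger ^ (2 ^ (m + 1) - 1)) p)) =
        ((‖aeval (φ ζ) p‖ ^ 2 : ℝ) : ℂ) := fun φ p ↦ by
    have h1 : φ ζ ^ 2 ^ (m + 1) = 1 := by rw [← map_pow, hζ.pow_eq_one, map_one]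
    have h2 := haeval φ 1 p
    rw [pow_one, pow_one] at h2
    rw [map_mul, map_mul, haeval, h2, ← conj_aeval_eq (by positivity) h1, Complex.mul_conj,
      Complex.normSq_eq_norm_sq]
  have hprod : ∀ p : ℤ[X], ‖aeval z p‖ ^ 2 = 2 ^ n →
      aeval hζ.toInteger p * aeval (hζ.toInteger ^ (2 ^ (m + 1) - 1)) p = 2 ^ n := fun p hp ↦ by
    apply RingOfIntegers.coe_injective
    apply ψ.injective
    rw [hmul, hψ, hp]
    simp only [map_pow, map_ofNat, Complex.ofReal_pow, Complex.ofReal_ofNat]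
  have hnorm : ∀ p : ℤ[X], ‖aeval z p‖ ^ 2 = 2 ^ n → ∀ φ : K →+* ℂ,
      ‖φ (algebraMap (𝓞 K) K (aeval hζ.toInteger p))‖ ^ 2 = 2 ^ n := fun p hp φ ↦ by
    have h1 := hmul φ p
    have h2 := haeval φ 1 p
    rw [pow_one, pow_one] at h2
    rw [hprod p hp, ← h2] at h1
    have h3 : ((2 ^ n : ℝ) : ℂ) = ((‖φ (algebraMap (𝓞 K) K (aeval hζ.toInteger p))‖ ^ 2 : ℝ) : ℂ) := by
      rw [← h1]
      simp only [map_pow, map_ofNat, Complex.ofReal_pow, Complex.ofReal_ofNat]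
    exact (Complex.ofReal_injective h3).symm
  obtain ⟨j, hj⟩ := exists_eq_pow_mul hζ (Dvd.intro _ (hprod p hp)) (Dvd.intro _ (hprod q hq))
    fun φ ↦ by
      rw [← sq_eq_sq₀ (norm_nonneg _) (norm_nonneg _), hnorm p hp, hnorm q hq]
  refine ⟨j, ?_⟩
  have h := congrArg ψ hj
  have h1 := haeval ψ 1 p
  have h2 := haeval ψ 1 q
  rw [pow_one, pow_one] at h1 h2
  rw [map_mul, map_pow, h1, h2, hψ] at h
  exact h

end Cyclotomic

/-- Two elements of `ℤ[ζ_{2^k}]` of absolute value `2^{n/2}` differ by a power of `ζ_{2^k}`. -/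
theorem exists_aeval_eq_pow_mul {m n : ℕ} {z : ℂ} (hz : IsPrimitiveRoot z (2 ^ (m + 1)))
    {p q : ℤ[X]} (hp : ‖aeval z p‖ ^ 2 = 2 ^ n) (hq : ‖aeval z q‖ ^ 2 = 2 ^ n) :
    ∃ j : ℕ, aeval z p = z ^ j * aeval z q := by
  have : IsCyclotomicExtension {2 ^ (m + 1)} ℚ (CyclotomicField (2 ^ (m + 1)) ℚ) := by
    convert! CyclotomicField.isCyclotomicExtension (2 ^ (m + 1)) ℚ
  have hζ := IsCyclotomicExtension.zeta_spec (2 ^ (m + 1)) ℚ (CyclotomicField (2 ^ (m + 1)) ℚ)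
  obtain ⟨ψ, hψ⟩ := exists_ringHom_eq hζ hz
  exact exists_aeval_eq_pow_mul_of_ringHom hζ ψ hψ hp hq

/-! ### Explicit roots of unity and linear independence -/

open IntermediateField

theorem zeta_isPrimitiveRoot (k : ℕ) : IsPrimitiveRoot (zeta k) (2 ^ k) := by
  have h := Complex.isPrimitiveRoot_exp (2 ^ k) (by positivity)
  simpa [zeta] using h

theorem zeta_pow_two_pow (a b : ℕ) : zeta (a + b) ^ 2 ^ a = zeta b := by
  rw [zeta, zeta, ← Complex.exp_nat_mul]
  congr 1
  push_cast
  rw [pow_add]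
  field_simp

theorem zeta_ne_zero (k : ℕ) : zeta k ≠ 0 := Complex.exp_ne_zero _

theorem zeta_pow_mod (k a : ℕ) : zeta k ^ (a % 2 ^ k) = zeta k ^ a := by
  rw [(zeta_isPrimitiveRoot k).eq_orderOf, pow_mod_orderOf]

theorem zeta_three_add_pow_seven : zeta 3 + zeta 3 ^ 7 = (√2 : ℝ) := by
  have h3 : zeta 3 = Complex.exp ((Real.pi / 4 : ℝ) * Complex.I) := by
    rw [zeta]; congr 1; push_cast; ring
  have h7 : zeta 3 ^ 7 = (zeta 3)⁻¹ := by
    refine eq_inv_of_mul_eq_one_left ?_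
    rw [← pow_succ]
    exact (zeta_isPrimitiveRoot 3).pow_eq_one
  rw [h7, h3, ← Complex.exp_neg, ← neg_mul, ← Complex.ofReal_neg, Complex.exp_mul_I,
    Complex.exp_mul_I, ← Complex.ofReal_cos, ← Complex.ofReal_sin, ← Complex.ofReal_cos,
    ← Complex.ofReal_sin, Real.cos_neg, Real.sin_neg, Real.cos_pi_div_four]
  push_cast
  ring

/-- `2^{n/2}` lies in `ℤ[ζ_{2^k}]` if `n` is even or `k ≥ 3`. -/
theorem exists_aeval_eq_two_rpow {n k : ℕ} (h : Even n ∨ 3 ≤ k) :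
    ∃ p : ℤ[X], aeval (zeta k) p = (((2 : ℝ) ^ ((n : ℝ) / 2) : ℝ) : ℂ) := by
  rcases h with ⟨t, rfl⟩ | h
  · refine ⟨2 ^ t, ?_⟩
    have : (((t + t : ℕ) : ℝ) / 2) = t := by push_cast; ring
    rw [this, Real.rpow_natCast, map_pow, map_ofNat, Complex.ofReal_pow, Complex.ofReal_ofNat]
  · obtain ⟨t, rfl⟩ := Nat.exists_eq_add_of_le' h
    -- Here `ζ_{2^k}^{2^t} = ζ_8`, and `ζ_8 + ζ_8⁻¹ = √2`.
    refine ⟨(X ^ 2 ^ t + (X ^ 2 ^ t) ^ 7) ^ n, ?_⟩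
    simp only [map_pow, map_add, aeval_X]
    rw [zeta_pow_two_pow, zeta_three_add_pow_seven, ← Complex.ofReal_pow, Real.sqrt_eq_rpow,
      ← Real.rpow_natCast, ← Real.rpow_mul zero_le_two]
    congr 2
    ring

theorem two_rpow_half_sq (n : ℕ) : ((2 : ℝ) ^ ((n : ℝ) / 2)) ^ 2 = 2 ^ n := by
  rw [← Real.rpow_natCast, ← Real.rpow_mul zero_le_two, ← Real.rpow_natCast]
  congr 1
  push_cast
  ring

/-- The powers `ζ_{2^{s+ℓ}}^i`, `i < 2^s`, are linearly independent over `ℚ(ζ_{2^ℓ})`. -/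
theorem linearIndependent_zeta_pow (s m : ℕ) :
    LinearIndependent ℚ⟮zeta (m + 1)⟯ fun i : Fin (2 ^ s) ↦ zeta (s + (m + 1)) ^ (i : ℕ) := by
  set F := ℚ⟮zeta (m + 1)⟯
  set z := zeta (s + (m + 1))
  have hdeg : ∀ a, (minpoly ℚ (zeta (a + 1))).natDegree = 2 ^ a := fun a ↦ by
    rw [← cyclotomic_eq_minpoly_rat (zeta_isPrimitiveRoot (a + 1)) (by positivity),
      natDegree_cyclotomic, Nat.totient_prime_pow_succ Nat.prime_two]
    simp
  have hintQ : ∀ a, IsIntegral ℚ (zeta a) := fun a ↦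
    ((zeta_isPrimitiveRoot a).isIntegral (by positivity)).tower_top
  have hint : IsIntegral F z := (hintQ _).tower_top
  have : FiniteDimensional ℚ F := adjoin.finiteDimensional (hintQ _)
  have : FiniteDimensional F F⟮z⟯ := adjoin.finiteDimensional hint
  have : FiniteDimensional ℚ F⟮z⟯ := FiniteDimensional.trans ℚ F F⟮z⟯
  have hdegz : (minpoly ℚ z).natDegree = 2 ^ (s + m) := hdeg (s + m)
  -- Tower law: `2^{s+m} ≤ [F(z):ℚ] = 2^m · [F(z):F]`.
  have h1 := minpoly.natDegree_le (A := ℚ) (AdjoinSimple.gen F z)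
  rw [← minpoly.algebraMap_eq (B' := ℂ) (algebraMap F⟮z⟯ ℂ).injective,
    AdjoinSimple.algebraMap_gen, hdegz, ← Module.finrank_mul_finrank ℚ F F⟮z⟯,
    adjoin.finrank (hintQ _), hdeg, adjoin.finrank hint, pow_add, mul_comm] at h1
  have hle : 2 ^ s ≤ (minpoly F z).natDegree := Nat.le_of_mul_le_mul_left h1 (by positivity)
  exact (linearIndependent_pow z).comp (Fin.castLE hle) (Fin.castLE_injective hle)

theorem aeval_zeta_mem (ℓ : ℕ) (p : ℤ[X]) : aeval (zeta ℓ) p ∈ ℚ⟮zeta ℓ⟯ := by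
  rw [aeval_eq_sum_range]
  exact sum_mem fun i _ ↦ zsmul_mem (pow_mem (mem_adjoin_simple_self ℚ _) i) _

theorem zeta_mem (ℓ : ℕ) : zeta ℓ ∈ ℚ⟮zeta ℓ⟯ := mem_adjoin_simple_self ℚ _

theorem sign_eq_intCast {n : ℕ} (u x : V n) : sign u x = (((-1) ^ (u ⬝ᵥ x).val : ℤ) : ℂ) := by
  simp [sign]

/-! ### Digits, the dual and the partition coefficients -/

theorem sum_digits_eq_mod (ℓ s a : ℕ) :
    ∑ j ∈ Finset.range s, (a / 2 ^ (j * ℓ) % 2 ^ ℓ) * 2 ^ (j * ℓ) = a % 2 ^ (s * ℓ) := by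
  induction s with
  | zero => simp [Nat.mod_one]
  | succ s ih =>
    rw [Finset.sum_range_succ, ih, Nat.succ_mul, pow_add, Nat.mod_mul]
    ring

theorem digit_mod {ℓ s j : ℕ} (hj : j < s) (a : ℕ) :
    a % 2 ^ (s * ℓ) / 2 ^ (j * ℓ) % 2 ^ ℓ = a / 2 ^ (j * ℓ) % 2 ^ ℓ := by
  obtain ⟨d, rfl⟩ := Nat.exists_eq_add_of_lt hj
  rw [show (j + d + 1) * ℓ = j * ℓ + (ℓ + d * ℓ) by ring, pow_add, Nat.mod_mul_right_div_self,
    pow_add, Nat.mod_mul_right_mod]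

/-- Turns the cells `P_α` into residue classes mod `2^{(r-1)ℓ}`. -/
theorem lower_eq_lower_iff {n k ℓ r : ℕ} (f g : V n → ZMod (2 ^ k)) (x u : V n) :
    lower ℓ r f x = lower ℓ r g u ↔
      (f x).val % 2 ^ ((r - 1) * ℓ) = (g u).val % 2 ^ ((r - 1) * ℓ) := by
  simp only [lower, component, funext_iff, ZMod.natCast_eq_natCast_iff']
  refine ⟨fun h ↦ ?_, fun h j ↦ ?_⟩
  · rw [← sum_digits_eq_mod, ← sum_digits_eq_mod]
    exact Finset.sum_congr rfl fun j hj ↦ by rw [h ⟨j, Finset.mem_range.1 hj⟩]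
  · rw [← digit_mod j.2, h, digit_mod j.2]

theorem zeta_pow_component {n k : ℕ} (ℓ j : ℕ) (f : V n → ZMod (2 ^ k)) (x : V n) :
    zeta ℓ ^ (component ℓ f j x).val = zeta ℓ ^ ((f x).val / 2 ^ (j * ℓ)) := by
  rw [component, ZMod.val_natCast, zeta_pow_mod]

theorem zeta_pow_eq (s ℓ a : ℕ) :
    zeta (s + ℓ) ^ a = zeta (s + ℓ) ^ (a % 2 ^ s) * zeta ℓ ^ (a / 2 ^ s) := by
  rw [← zeta_pow_two_pow s ℓ, ← pow_mul, ← pow_add, Nat.mod_add_div]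

theorem exists_aeval_eq_WHT {n k : ℕ} (f : V n → ZMod (2 ^ k)) (u : V n) :
    ∃ p : ℤ[X], aeval (zeta k) p = WHT f u :=
  ⟨∑ x, X ^ (f x).val * C ((-1) ^ (u ⬝ᵥ x).val : ℤ), by simp [WHT, sign]⟩

theorem IsGbent.exists_isDual {n k : ℕ} (hk : 1 ≤ k) (hn : Even n ∨ 3 ≤ k)
    {f : V n → ZMod (2 ^ k)} (hf : IsGbent f) : ∃ g, IsDual f g := by
  have h : ∀ u, ∃ a : ZMod (2 ^ k),
      WHT f u = (((2 : ℝ) ^ ((n : ℝ) / 2) : ℝ) : ℂ) * zeta k ^ a.val := fun u ↦ by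
    obtain ⟨m, rfl⟩ := Nat.exists_eq_add_of_le' hk
    obtain ⟨p, hp⟩ := exists_aeval_eq_WHT f u
    obtain ⟨q, hq⟩ := exists_aeval_eq_two_rpow hn
    have hpn : ‖aeval (zeta (m + 1)) p‖ ^ 2 = 2 ^ n := by rw [hp, hf, two_rpow_half_sq]
    have hqn : ‖aeval (zeta (m + 1)) q‖ ^ 2 = 2 ^ n := by
      rw [hq, Complex.norm_real, Real.norm_eq_abs, sq_abs, two_rpow_half_sq]
    obtain ⟨j, hj⟩ := exists_aeval_eq_pow_mul (zeta_isPrimitiveRoot (m + 1)) hpn hqn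
    exact ⟨j, by rw [ZMod.val_natCast, zeta_pow_mod, ← hp, hj, hq, mul_comm]⟩
  choose g hg using h
  exact ⟨g, hg⟩

theorem two_rpow_half_ne_zero (n : ℕ) : (((2 : ℝ) ^ ((n : ℝ) / 2) : ℝ) : ℂ) ≠ 0 :=
  Complex.ofReal_ne_zero.2 (by positivity)

theorem IsDual.unique {n k : ℕ} {f g h : V n → ZMod (2 ^ k)} (hg : IsDual f g)
    (hh : IsDual f h) : g = h := by
  funext u
  have huv := mul_left_cancel₀ (two_rpow_half_ne_zero n) ((hg u).symm.trans (hh u))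
  exact ZMod.val_injective _
    ((zeta_isPrimitiveRoot k).pow_inj (ZMod.val_lt _) (ZMod.val_lt _) huv)

theorem IsDual.sum_filter_mod_eq {n s m : ℕ} (hn : Even n ∨ 3 ≤ m + 1)
    {f g : V n → ZMod (2 ^ (s + (m + 1)))} (hg : IsDual f g) (u : V n) {i : ℕ} (hi : i < 2 ^ s) :
    ∑ x with (f x).val % 2 ^ s = i, zeta (m + 1) ^ ((f x).val / 2 ^ s) * sign u x =
      if (g u).val % 2 ^ s = i then
        (((2 : ℝ) ^ ((n : ℝ) / 2) : ℝ) : ℂ) * zeta (m + 1) ^ ((g u).val / 2 ^ s) else 0 := by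
  set F := ℚ⟮zeta (m + 1)⟯
  set c : ℂ := (((2 : ℝ) ^ ((n : ℝ) / 2) : ℝ) : ℂ) * zeta (m + 1) ^ ((g u).val / 2 ^ s) with hc
  -- Here the parity condition is needed at level `ℓ`; existence of the dual uses it only at level
  -- `k`.
  have hcF : c ∈ F := by
    obtain ⟨q, hq⟩ := exists_aeval_eq_two_rpow hn
    rw [hc, ← hq]
    exact mul_mem (aeval_zeta_mem _ _) (pow_mem (zeta_mem _) _)
  let D : ℕ → F := fun i ↦
    ⟨∑ x with (f x).val % 2 ^ s = i, zeta (m + 1) ^ ((f x).val / 2 ^ s) * sign u x,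
      sum_mem fun x _ ↦ mul_mem (pow_mem (zeta_mem _) _)
        (by rw [sign_eq_intCast]; exact intCast_mem F _)⟩
  let E : ℕ → F := fun i ↦ if (g u).val % 2 ^ s = i then ⟨c, hcF⟩ else 0
  have hD : ∑ i : Fin (2 ^ s), (D i : ℂ) * zeta (s + (m + 1)) ^ (i : ℕ) = WHT f u := by
    rw [Fin.sum_univ_eq_sum_range (fun i ↦ (D i : ℂ) * zeta (s + (m + 1)) ^ i), WHT,
      ← Finset.sum_fiberwise_of_maps_to (s := Finset.univ) (t := Finset.range (2 ^ s))
        (g := fun x ↦ (f x).val % 2 ^ s)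
        (fun x _ ↦ Finset.mem_range.2 (Nat.mod_lt _ (by positivity)))]
    refine Finset.sum_congr rfl fun i _ ↦ ?_
    rw [Finset.sum_mul]
    refine Finset.sum_congr rfl fun x hx ↦ ?_
    rw [zeta_pow_eq s (m + 1) (f x).val, (Finset.mem_filter.1 hx).2]
    ring
  have hE : ∑ i : Fin (2 ^ s), (E i : ℂ) * zeta (s + (m + 1)) ^ (i : ℕ) = WHT f u := by
    rw [Fin.sum_univ_eq_sum_range (fun i ↦ (E i : ℂ) * zeta (s + (m + 1)) ^ i),
      Finset.sum_eq_single_of_mem ((g u).val % 2 ^ s)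
        (Finset.mem_range.2 (Nat.mod_lt _ (by positivity)))
        (fun i _ hi ↦ by simp [E, hi.symm]), hg u, zeta_pow_eq s (m + 1) (g u).val]
    simp only [E, if_true, hc]
    ring
  have hli := Fintype.linearIndependent_iff.1 (linearIndependent_zeta_pow s m)
    (fun i ↦ D i - E i) (by
      simp only [sub_smul, Finset.sum_sub_distrib]
      exact sub_eq_zero.2 (hD.trans hE.symm)) ⟨i, hi⟩
  have := congrArg (Subtype.val) (sub_eq_zero.1 hli)
  simp only [D, E] at this
  rw [this]
  split_ifs <;> rfl

theorem IsDual.coeff_eq {n k ℓ r : ℕ} (hℓ : 1 ≤ ℓ) (hr : 1 ≤ r) (hk : k = ℓ * r)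
    (hn : Even n ∨ 3 ≤ ℓ) {f g : V n → ZMod (2 ^ k)} (hg : IsDual f g) (u : V n)
    (α : Fin (r - 1) → ZMod (2 ^ ℓ)) :
    coeff ℓ r f α u = if lower ℓ r g u = α then
      (((2 : ℝ) ^ ((n : ℝ) / 2) : ℝ) : ℂ) * zeta ℓ ^ (component ℓ g (r - 1) u).val else 0 := by
  obtain ⟨m, rfl⟩ := Nat.exists_eq_add_of_le' hℓ
  obtain rfl : k = (r - 1) * (m + 1) + (m + 1) := by
    obtain ⟨t, rfl⟩ := Nat.exists_eq_add_of_le' hr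
    rw [hk, Nat.add_sub_cancel]; ring
  -- Residues only describe tuples that occur as lower digits. If `α` is neither that of `g` at `u`
  -- nor that of `f` anywhere, the cell is empty and both sides are 0.
  have key : ∀ (h : V n → ZMod (2 ^ ((r - 1) * (m + 1) + (m + 1)))) (y : V n),
      lower (m + 1) r h y = α → coeff (m + 1) r f α u = if lower (m + 1) r g u = α then
      (((2 : ℝ) ^ ((n : ℝ) / 2) : ℝ) : ℂ) * zeta (m + 1) ^ (component (m + 1) g (r - 1) u).val
      else 0 := by
    rintro h y rfl
    simp only [coeff, cell, lower_eq_lower_iff, zeta_pow_component]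
    exact hg.sum_filter_mod_eq hn u (Nat.mod_lt _ (by positivity))
  by_cases hα : lower (m + 1) r g u = α
  · exact key g u hα
  rcases (cell (m + 1) r f α).eq_empty_or_nonempty with he | ⟨x, hx⟩
  · rw [coeff, he, Finset.sum_empty, if_neg hα]
  · exact key f x (Finset.mem_filter.1 hx).2

end Gbent

theorem mainTheorem10 (n k ℓ r : ℕ) (hℓ : 1 ≤ ℓ) (hr : 1 ≤ r) (hk : k = ℓ * r)
    (hn : Even n ∨ 3 ≤ ℓ) (f : Gbent.V n → ZMod (2 ^ k)) (hf : Gbent.IsGbent f) :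
    (∃! ftilde : Gbent.V n → ZMod (2 ^ k), Gbent.IsDual f ftilde) ∧
    ∀ ftilde : Gbent.V n → ZMod (2 ^ k), Gbent.IsDual f ftilde →
      ∀ u : Gbent.V n,
        ∃ αstar : Fin (r - 1) → ZMod (2 ^ ℓ),
          (Gbent.coeff ℓ r f αstar u ≠ 0 ∧ ∀ α, Gbent.coeff ℓ r f α u ≠ 0 → α = αstar) ∧
          Gbent.lower ℓ r ftilde u = αstar := by
  have hle : ℓ ≤ k := hk ▸ Nat.le_mul_of_pos_right ℓ hr
  obtain ⟨g, hg⟩ := hf.exists_isDual (hℓ.trans hle) (hn.imp_right fun h ↦ h.trans hle)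
  refine ⟨⟨g, hg, fun h hh ↦ hh.unique hg⟩, fun h hh u ↦ ⟨Gbent.lower ℓ r h u, ⟨?_, ?_⟩, rfl⟩⟩
  · rw [hh.coeff_eq hℓ hr hk hn, if_pos rfl]
    exact mul_ne_zero (Gbent.two_rpow_half_ne_zero n) (pow_ne_zero _ (Gbent.zeta_ne_zero ℓ))
  · intro α hα
    by_contra hne
    exact hα (by rw [hh.coeff_eq hℓ hr hk hn, if_neg (Ne.symm hne)])
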